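/- Let $F:\mathbb R^n\rightrightarrows\mathbb R^n$ be a multifunction satisfying assumption (F): (F1) $F(x)$ is nonempty, convex and compact for every $x$; (F2) for each compact $C\subset\mathbb R^n$ there is $L>0$ with $F(x)\subset F(y)+L|y-x|\bar{\mathbb B}$ for all $x,y\in C$, where $\bar{\mathbb B}$ is the closed unit ball; (F3) there is $\gamma>0$ with $|v|\le\gamma(1+|x|)$ for all $x$ and all $v\in F(x)$. Let $\mathcal K\subset\mathbb R^n$ be a closed set (the target). A trajectory of $F$ on $[0,T]$ is an absolutely continuous $y:[0,T]\to\mathbb R^n$ with $\dot y(t)\in F(y(t))$ for a.e. $t\in[0,T]$. Let $\mathcal T:\mathbb R^n\to[0,+\infty]$ be the minimum time function: $\mathcal T(x)=0$ for $x\in\mathcal K$, and for $x\notin\mathcal K$, $\mathcal T(x)$ is the infimum of all $T>0$ for which there is a trajectory $y$ of $F$ on $[0,T]$ with $y(0)=x$ and $y(T)\in\mathcal K$ ($+\infty$ if there is none). Put $\mathcal R=\{x:\mathcal T(x)<+\infty\}$, $\mathcal R(t)=\{x:\mathcal T(x)\le t\}$, and $\mathrm{epi}(\mathcal T)=\{(x,\beta)\in\mathbb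 R^n\times\mathbb R:\mathcal T(x)<+\infty,\ \beta\ge\mathcal T(x)\}$. For a subset $E$ of a Euclidean space and $z\in E$, the proximal normal cone $N^P_E(z)$ is the set of all $v$ for which there is $\sigma\ge0$ with $\langle v,w-z\rangle\le\sigma|w-z|^2$ for all $w\in E$. A number $\kappa\in\mathbb N$ is called the dimension of a cone $C$, in the sense of linearly independent conic generators, if there are linearly independent $v_1,\dots,v_\kappa\in C$ such that every $v\in C$ is of the form $\lambda_1v_1+\dots+\lambda_\kappa v_\kappa$ with all $\lambda_i\ge0$; not every cone has a dimension in this sense. The linear dimension of $C$ is the dimension of its linear span, i.e. the largest number of linearly independent elements of $C$; it agrees with the former dimension whenever that exists. Then for every $x\in\mathcal R\setminus\mathcal K$ the cones $N^P_{\mathcal R(\mathcal T(x))}(x)\subset\mathbb R^n$ and $N^P_{\mathrm{epi}(\mathcal T)}(x,\mathcal T(x))\subset\mathbb R^n\times\mathbb R$ have the same dimension, $$\dim N^P_{\mathcal R(\mathcal T(x))}(x)=\dim N^P_{\mathrm{epi}(\mathcal T)}(x,\mathcal T(x)),$$ in both senses: for each $\kappa\in\mathbb N$, one of the two cones has dimension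 $\kappa$ in the sense of linearly independent conic generators if and only if the other does; and, in all cases, the two cones have the same linear dimension. -/

import Mathlib

open Set MeasureTheory
open scoped Pointwise ENNReal

noncomputable section

namespace MinTime

/-- The proximal normal cone to `K` at `x` (meant for `x ∈ K`). -/
def proxNormalCone {E : Type*} [NormedAddCommGroup E] [InnerProductSpace ℝ E]
    (K : Set E) (x : E) : Set E :=
  {v | ∃ σ : ℝ, 0 ≤ σ ∧ ∀ y ∈ K, inner ℝ v (y - x) ≤ σ * ‖y - x‖ ^ 2}

/-- `κ` is the dimension of the cone `C` in the sense of linearly independent conic generators: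
some `κ` linearly independent elements of `C` generate every element of `C` with nonnegative
coefficients. -/
def ConeHasDim {V : Type*} [AddCommGroup V] [Module ℝ V] (C : Set V) (κ : ℕ) : Prop :=
  ∃ v : Fin κ → V, (∀ i, v i ∈ C) ∧ LinearIndependent ℝ v ∧
    ∀ w ∈ C, ∃ c : Fin κ → ℝ, (∀ i, 0 ≤ c i) ∧ w = ∑ i, c i • v i

/-- The epigraph of an extended-real-valued function, as a subset of the Euclidean product
(`WithLp 2` carries the inner product `⟪x, y⟫ + α β`). -/
def epigraph {E : Type*} (f : E → EReal) : Set (WithLp 2 (E × ℝ)) :=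
  {p | f p.fst < ⊤ ∧ f p.fst ≤ (p.snd : EReal)}

variable {n : ℕ}

/-- The standing assumptions on the multifunction `F`. -/
structure AssumptionF (F : EuclideanSpace ℝ (Fin n) → Set (EuclideanSpace ℝ (Fin n))) :
    Prop where
  nonempty : ∀ x, (F x).Nonempty
  convex : ∀ x, Convex ℝ (F x)
  compact : ∀ x, IsCompact (F x)
  locally_lipschitz : ∀ C : Set (EuclideanSpace ℝ (Fin n)), IsCompact C →
    ∃ L : ℝ, 0 < L ∧ ∀ x ∈ C, ∀ y ∈ C,
      F x ⊆ F y + (L * ‖y - x‖) • Metric.closedBall (0 : EuclideanSpace ℝ (Fin n)) 1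
  linear_growth : ∃ γ : ℝ, 0 < γ ∧ ∀ x, ∀ v ∈ F x, ‖v‖ ≤ γ * (1 + ‖x‖)

/-- `y` is, on `[0, T]`, an absolutely continuous solution of `y' ∈ F(y)` a.e. with `y 0 = x₀`.
Values of `y` outside `[0, T]` play no role. -/
structure IsTrajectory (F : EuclideanSpace ℝ (Fin n) → Set (EuclideanSpace ℝ (Fin n)))
    (T : ℝ) (x₀ : EuclideanSpace ℝ (Fin n)) (y : ℝ → EuclideanSpace ℝ (Fin n)) : Prop where
  absolutelyContinuous : AbsolutelyContinuousOnInterval y 0 T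
  init : y 0 = x₀
  inclusion : ∀ᵐ t ∂(volume.restrict (Icc 0 T)), ∃ v ∈ F (y t), HasDerivAt y v t

open Classical in
/-- The minimum time function of `F` with target `K`; the infimum of the empty set is `∞`. -/
def minTime (F : EuclideanSpace ℝ (Fin n) → Set (EuclideanSpace ℝ (Fin n)))
    (K : Set (EuclideanSpace ℝ (Fin n))) (x : EuclideanSpace ℝ (Fin n)) : ℝ≥0∞ :=
  if x ∈ K then 0
  else sInf {τ | ∃ T : ℝ, 0 < T ∧ (∃ y, IsTrajectory F T x y ∧ y T ∈ K) ∧ τ = ENNReal.ofReal T}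

/-- The sublevel set `R(t)` of the minimum time function. -/
def reachableWithin (F : EuclideanSpace ℝ (Fin n) → Set (EuclideanSpace ℝ (Fin n)))
    (K : Set (EuclideanSpace ℝ (Fin n))) (t : ℝ≥0∞) : Set (EuclideanSpace ℝ (Fin n)) :=
  {x | minTime F K x ≤ t}

/-- The reachable set `R`. -/
def reachableSet (F : EuclideanSpace ℝ (Fin n) → Set (EuclideanSpace ℝ (Fin n)))
    (K : Set (EuclideanSpace ℝ (Fin n))) : Set (EuclideanSpace ℝ (Fin n)) :=
  {x | minTime F K x < ⊤}

end MinTime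

end

/-! Write `r` for the minimum time at `x` and `h(ζ) = min ⟪ζ, v⟫` over `v ∈ F x`. The normal cone to
the epigraph at `(x, r)` is exactly the graph of `h` over the normal cone to the sublevel set.
Projection to the first factor is thus a linear map carrying one convex cone bijectively onto the
other. Elements of the span of a convex cone are differences of its elements, so the projection is
injective on the span and preserves both dimensions.

The graph property is dynamic programming to second order. Near-optimal trajectories lower the
minimum time at unit speed (`exists_forward`); reversed trajectories raise it at most at unit speed
(`exists_backward`, through Filippov's theorem). A normal `ζ` to the sublevel set lifts to `(ζ,
h(ζ))`: points of the epigraph above or below height `r` are carried forwards or backwards into the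
sublevel set, with quadratic error. Conversely, slicing at height `r` projects normals down, and
testing a normal against forward and backward displacements of `x` forces its last coordinate to be
`h`. Small slacks in the time replace the existence of optimal trajectories. -/

namespace MinTime

/-! ### Trajectories: surgery and a priori bounds. -/

/-- Precomposition of an absolutely continuous function with a nonexpansive map that sends disjoint
intervals to disjoint intervals. -/
theorem absolutelyContinuousOnInterval_comp {X : Type*} [PseudoMetricSpace X] {f : ℝ → X}
    {a b c d : ℝ} (hf : AbsolutelyContinuousOnInterval f c d) (φ ψ : ℝ → ℝ)
    (hmaps : ∀ t ∈ uIcc a b, φ t ∈ uIcc c d) (hdist : ∀ u v, dist (φ u) (φ v) ≤ dist u v)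
    (hψ : ∀ u v, ∀ t ∈ uIoc (φ u) (φ v), ψ t ∈ uIoc u v) :
    AbsolutelyContinuousOnInterval (fun t => f (φ t)) a b := by
  rw [absolutelyContinuousOnInterval_iff] at hf ⊢
  intro ε hε
  obtain ⟨δ, hδ, H⟩ := hf ε hε
  refine ⟨δ, hδ, fun E hE hlen => ?_⟩
  refine H (E.1, fun i => (φ (E.2 i).1, φ (E.2 i).2)) ⟨fun i hi => ?_, fun i hi j hj hij => ?_⟩ ?_
  · exact ⟨hmaps _ (hE.1 i hi).1, hmaps _ (hE.1 i hi).2⟩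
  · refine Set.disjoint_left.2 fun t ht ht' => ?_
    exact Set.disjoint_left.1 (hE.2 hi hj hij) (hψ _ _ t ht) (hψ _ _ t ht')
  · exact lt_of_le_of_lt (Finset.sum_le_sum fun i _ => hdist _ _) hlen

variable {n : ℕ}

/-- The time-`τ` tail of a trajectory is a trajectory. -/
theorem IsTrajectory.tail {F : EuclideanSpace ℝ (Fin n) → Set (EuclideanSpace ℝ (Fin n))}
    {T τ : ℝ} {x₀ : EuclideanSpace ℝ (Fin n)} {y : ℝ → EuclideanSpace ℝ (Fin n)}
    (h : IsTrajectory F T x₀ y) (hτ : 0 ≤ τ) (hτT : τ ≤ T) :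
    IsTrajectory F (T - τ) (y τ) (fun t => y (t + τ)) where
  absolutelyContinuous := by
    refine absolutelyContinuousOnInterval_comp h.absolutelyContinuous (fun t => t + τ)
      (fun t => t - τ) (fun t ht => ?_) (fun u v => by simp) (fun u v t ht => ?_)
    · rw [uIcc_of_le (by linarith)] at ht
      rw [uIcc_of_le (by linarith)]
      exact ⟨by linarith [ht.1], by linarith [ht.2]⟩
    · rw [mem_uIoc] at ht ⊢
      rcases ht with ht | ht
      · exact Or.inl ⟨by linarith [ht.1], by linarith [ht.2]⟩
      · exact Or.inr ⟨by linarith [ht.1], by linarith [ht.2]⟩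
  init := by simp
  inclusion := by
    have h1 := (ae_restrict_iff' measurableSet_Icc).1 h.inclusion
    rw [ae_restrict_iff' measurableSet_Icc]
    have h2 := (quasiMeasurePreserving_add_right (volume : Measure ℝ) τ).ae h1
    filter_upwards [h2] with t ht htm
    obtain ⟨v, hv, hd⟩ := ht ⟨by linarith [htm.1], by linarith [htm.2]⟩
    exact ⟨v, hv, hd.comp_add_const t τ⟩

/-- Clamping the time in each piece writes the glued curve as a sum, so absolute continuity needs no
gluing argument. Since `q 0 = p S`, the formula is `p` before `S` and the shifted `q` after it. -/
theorem IsTrajectory.concat {F : EuclideanSpace ℝ (Fin n) → Set (EuclideanSpace ℝ (Fin n))}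
    {S T : ℝ} {a : EuclideanSpace ℝ (Fin n)} {p q : ℝ → EuclideanSpace ℝ (Fin n)}
    (hS : 0 ≤ S) (hT : 0 ≤ T) (hp : IsTrajectory F S a p) (hq : IsTrajectory F T (p S) q) :
    IsTrajectory F (S + T) a (fun t => p (min t S) + q (max (t - S) 0) - p S) where
  absolutelyContinuous := by
    have h1 : AbsolutelyContinuousOnInterval (fun t => p (min t S)) 0 (S + T) := by
      refine absolutelyContinuousOnInterval_comp hp.absolutelyContinuous (fun t => min t S) id
        (fun t ht => ?_) (fun u v => ?_) (fun u v t ht => ?_)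
      · rw [uIcc_of_le (by linarith)] at ht
        rw [uIcc_of_le hS]
        exact ⟨le_min ht.1 hS, min_le_right _ _⟩
      · simp only [Real.dist_eq]
        simpa using abs_min_sub_min_le_max u S v S
      · simp only [mem_uIoc, id] at ht ⊢; grind
    have h2 : AbsolutelyContinuousOnInterval (fun t => q (max (t - S) 0)) 0 (S + T) := by
      refine absolutelyContinuousOnInterval_comp hq.absolutelyContinuous (fun t => max (t - S) 0)
        (fun t => t + S) (fun t ht => ?_) (fun u v => ?_) (fun u v t ht => ?_)
      · rw [uIcc_of_le (by linarith)] at ht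
        rw [uIcc_of_le hT]
        exact ⟨le_max_right _ _, max_le (by linarith [ht.2]) hT⟩
      · simp only [Real.dist_eq]
        exact (abs_max_sub_max_le_abs (u - S) (v - S) 0).trans_eq (by ring_nf)
      · simp only [mem_uIoc] at ht ⊢; grind
    have h3 : AbsolutelyContinuousOnInterval (fun _ : ℝ => p S) 0 (S + T) :=
      (LipschitzWith.const (p S)).lipschitzOnWith.absolutelyContinuousOnInterval
    exact (h1.add h2).sub h3
  init := by
    simp [hS, hp.init, hq.init]
  inclusion := by
    have h1 := (ae_restrict_iff' measurableSet_Icc).1 hp.inclusion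
    have h2 := (quasiMeasurePreserving_add_right (volume : Measure ℝ) (-S)).ae
      ((ae_restrict_iff' measurableSet_Icc).1 hq.inclusion)
    rw [ae_restrict_iff' measurableSet_Icc]
    -- The junction time may be a corner, but it is a null set.
    filter_upwards [h1, h2, (volume : Measure ℝ).ae_ne S] with t ht1 ht2 hne htm
    rcases lt_or_gt_of_ne hne with hlt | hgt
    · obtain ⟨v, hv, hd⟩ := ht1 ⟨htm.1, hlt.le⟩
      refine ⟨v, ?_, hd.congr_of_eventuallyEq ?_⟩
      · simpa [hlt.le, hq.init] using hv
      · filter_upwards [Iio_mem_nhds hlt] with u hu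
        have hu' : u ≤ S := le_of_lt hu
        simp [hu', hq.init]
    · obtain ⟨v, hv, hd⟩ := ht2 ⟨by linarith, by linarith [htm.2]⟩
      refine ⟨v, ?_, (hd.comp_add_const t (-S)).congr_of_eventuallyEq ?_⟩
      · simpa [hgt.le, sub_eq_add_neg] using hv
      · filter_upwards [Ioi_mem_nhds hgt] with u hu
        have hu' : S ≤ u := le_of_lt hu
        simp [hu', sub_eq_add_neg]

theorem isTrajectory_zero (F : EuclideanSpace ℝ (Fin n) → Set (EuclideanSpace ℝ (Fin n)))
    (a : EuclideanSpace ℝ (Fin n)) : IsTrajectory F 0 a (fun _ => a) where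
  absolutelyContinuous :=
    (LipschitzWith.const a).lipschitzOnWith.absolutelyContinuousOnInterval
  init := rfl
  inclusion := by simp

theorem minTime_le_of_isTrajectory
    {F : EuclideanSpace ℝ (Fin n) → Set (EuclideanSpace ℝ (Fin n))}
    {K : Set (EuclideanSpace ℝ (Fin n))} {T : ℝ} {a : EuclideanSpace ℝ (Fin n)}
    {p : ℝ → EuclideanSpace ℝ (Fin n)} (hT : 0 ≤ T) (hp : IsTrajectory F T a p) (hK : p T ∈ K) :
    minTime F K a ≤ ENNReal.ofReal T := by
  unfold minTime
  split_ifs with ha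
  · exact zero_le
  · refine sInf_le ⟨T, lt_of_le_of_ne hT ?_, ⟨p, hp, hK⟩, rfl⟩
    rintro rfl
    exact ha (hp.init ▸ hK)

theorem exists_isTrajectory_of_minTime_lt
    {F : EuclideanSpace ℝ (Fin n) → Set (EuclideanSpace ℝ (Fin n))}
    {K : Set (EuclideanSpace ℝ (Fin n))} {c : ℝ} {a : EuclideanSpace ℝ (Fin n)}
    (h : minTime F K a < ENNReal.ofReal c) :
    ∃ T p, 0 ≤ T ∧ T < c ∧ IsTrajectory F T a p ∧ p T ∈ K ∧ (a ∉ K → 0 < T) := by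
  by_cases ha : a ∈ K
  · exact ⟨0, fun _ => a, le_rfl, ENNReal.ofReal_pos.1 (zero_le.trans_lt h),
      isTrajectory_zero F a, ha, fun h => (h ha).elim⟩
  · unfold minTime at h
    rw [if_neg ha, sInf_lt_iff] at h
    obtain ⟨_, ⟨T, hT, ⟨p, hp, hpK⟩, rfl⟩, hlt⟩ := h
    exact ⟨T, p, hT.le, (ENNReal.ofReal_lt_ofReal_iff_of_nonneg hT.le).1 hlt, hp, hpK, fun _ => hT⟩

/-- A lower bound on the velocities in a direction integrates along trajectories. -/
theorem IsTrajectory.mul_le_inner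
    {F : EuclideanSpace ℝ (Fin n) → Set (EuclideanSpace ℝ (Fin n))}
    {T τ c : ℝ} {x₀ ζ : EuclideanSpace ℝ (Fin n)} {y : ℝ → EuclideanSpace ℝ (Fin n)}
    (h : IsTrajectory F T x₀ y) (hτ : 0 ≤ τ) (hτT : τ ≤ T)
    (hc : ∀ t ∈ Icc 0 τ, ∀ v ∈ F (y t), c ≤ inner ℝ ζ v) :
    τ * c ≤ inner ℝ ζ (y τ - x₀) := by
  have hy : AbsolutelyContinuousOnInterval y 0 τ := h.absolutelyContinuous.mono (by
    rw [uIcc_of_le hτ, uIcc_of_le (hτ.trans hτT)]; exact Icc_subset_Icc_right hτT)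
  have hg : AbsolutelyContinuousOnInterval (fun t => inner ℝ ζ (y t)) 0 τ := by
    refine squeeze_zero (fun E => Finset.sum_nonneg fun i _ => dist_nonneg) (fun E => ?_)
      (by simpa using Filter.Tendsto.const_mul ‖ζ‖ hy)
    rw [Finset.mul_sum]
    refine Finset.sum_le_sum fun i _ => ?_
    rw [dist_eq_norm, dist_eq_norm, ← inner_sub_right]
    exact norm_inner_le_norm _ _
  have hFTC := hg.integral_deriv_eq_sub
  have hmono : ∫ _ in (0 : ℝ)..τ, c ≤ ∫ t in (0 : ℝ)..τ, deriv (fun t => inner ℝ ζ (y t)) t := by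
    refine intervalIntegral.integral_mono_ae_restrict hτ (by simp) hg.intervalIntegrable_deriv ?_
    have h1 := ae_restrict_of_ae_restrict_of_subset (Icc_subset_Icc_right hτT) h.inclusion
    rw [Filter.EventuallyLE, ae_restrict_iff' measurableSet_Icc]
    filter_upwards [(ae_restrict_iff' measurableSet_Icc).1 h1] with t ht htm
    obtain ⟨v, hv, hd⟩ := ht htm
    have hd' : HasDerivAt (fun t => inner ℝ ζ (y t)) (inner ℝ ζ v) t := by
      simpa using (hasDerivAt_const t ζ).inner ℝ hd
    rw [hd'.deriv]
    exact hc t htm v hv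
  rw [hFTC] at hmono
  simpa [inner_sub_right, h.init] using hmono

/-- Testing `mul_le_inner` against minus the displacement `d` gives `‖d‖² ≤ τ ‖d‖ N`. -/
theorem IsTrajectory.norm_sub_le
    {F : EuclideanSpace ℝ (Fin n) → Set (EuclideanSpace ℝ (Fin n))}
    {T τ N : ℝ} {x₀ : EuclideanSpace ℝ (Fin n)} {y : ℝ → EuclideanSpace ℝ (Fin n)}
    (h : IsTrajectory F T x₀ y) (hτ : 0 ≤ τ) (hτT : τ ≤ T)
    (hN : ∀ t ∈ Icc 0 τ, ∀ v ∈ F (y t), ‖v‖ ≤ N) : ‖y τ - x₀‖ ≤ τ * N := by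
  have key := h.mul_le_inner (ζ := -(y τ - x₀)) (c := -(‖y τ - x₀‖ * N)) hτ hτT
    (fun t ht v hv => by
      have h1 := abs_real_inner_le_norm (y τ - x₀) v
      have h2 := mul_le_mul_of_nonneg_left (hN t ht v hv) (norm_nonneg (y τ - x₀))
      rw [inner_neg_left]
      linarith [le_abs_self (inner ℝ (y τ - x₀) v)])
  rw [inner_neg_left, real_inner_self_eq_norm_sq] at key
  rcases (norm_nonneg (y τ - x₀)).eq_or_lt with h0 | h0
  · rw [← h0]
    by_contra! hneg
    -- If `N < 0`, no velocity is admissible, so any lower bound holds vacuously; taking `c = 1`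
    -- forces `τ = 0`.
    have := h.mul_le_inner (ζ := 0) (c := 1) hτ hτT (fun t ht v hv => by
      have := (norm_nonneg v).trans (hN t ht v hv)
      nlinarith)
    simp at this
    have : τ = 0 := le_antisymm this hτ
    simp [this] at hneg
  · by_contra! hneg
    nlinarith

/-- A trajectory stays close to its initial point for a short time, by linear growth. -/
theorem IsTrajectory.norm_sub_le_of_growth
    {F : EuclideanSpace ℝ (Fin n) → Set (EuclideanSpace ℝ (Fin n))}
    {T τ γ : ℝ} {x₀ : EuclideanSpace ℝ (Fin n)} {y : ℝ → EuclideanSpace ℝ (Fin n)}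
    (hγ : 0 < γ) (hF : ∀ x, ∀ v ∈ F x, ‖v‖ ≤ γ * (1 + ‖x‖))
    (h : IsTrajectory F T x₀ y) (hτ : 0 ≤ τ) (hτT : τ ≤ T) (hτγ : τ * γ ≤ 1 / 2) :
    ∀ t ∈ Icc 0 τ, ‖y t - x₀‖ ≤ 2 * τ * (γ * (1 + ‖x₀‖)) := by
  have hcont : ContinuousOn y (Icc 0 τ) := by
    have := h.absolutelyContinuous.continuousOn
    rw [uIcc_of_le (hτ.trans hτT)] at this
    exact this.mono (Icc_subset_Icc_right hτT)
  -- The maximal displacement `m` satisfies `m ≤ τγ(1 + ‖x₀‖) + m/2`; absorbing `m/2` replaces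
  -- Gronwall's inequality.
  obtain ⟨t₀, ht₀, hmax⟩ := isCompact_Icc.exists_isMaxOn (nonempty_Icc.2 hτ)
    (hcont.sub continuousOn_const).norm (f := fun t => ‖y t - x₀‖)
  have hb := h.norm_sub_le (N := γ * (1 + ‖x₀‖ + ‖y t₀ - x₀‖)) ht₀.1 (ht₀.2.trans hτT)
    (fun t ht v hv => (hF _ v hv).trans (by
      have h1 : ‖y t - x₀‖ ≤ ‖y t₀ - x₀‖ := hmax ⟨ht.1, ht.2.trans ht₀.2⟩
      have h2 : ‖y t‖ ≤ ‖x₀‖ + ‖y t - x₀‖ := by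
        simpa using norm_add_le x₀ (y t - x₀)
      exact mul_le_mul_of_nonneg_left (by linarith) hγ.le))
  have hm := norm_nonneg (y t₀ - x₀)
  have h3 : t₀ * (γ * (1 + ‖x₀‖ + ‖y t₀ - x₀‖)) ≤ τ * (γ * (1 + ‖x₀‖ + ‖y t₀ - x₀‖)) := by
    gcongr; exact ht₀.2
  intro t ht
  have h4 : ‖y t - x₀‖ ≤ ‖y t₀ - x₀‖ := hmax ht
  have h5 := mul_le_mul_of_nonneg_right hτγ hm
  linarith

end MinTime

/-! ### Filippov's theorem by nearest-point iteration. -/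

namespace MinTime

section Filippov

variable {E : Type*} [NormedAddCommGroup E] [InnerProductSpace ℝ E]

theorem exists_nearest_point {A : Set E} (hne : A.Nonempty) (hc : IsCompact A)
    (hconv : Convex ℝ A) (p : E) :
    ∃ a ∈ A, (∀ w ∈ A, inner ℝ (p - a) (w - a) ≤ 0) ∧ ∀ w ∈ A, ‖p - a‖ ≤ ‖p - w‖ := by
  obtain ⟨a, ha, hmin⟩ := exists_norm_eq_iInf_of_complete_convex hne hc.isComplete hconv p
  refine ⟨a, ha, (norm_eq_iInf_iff_real_inner_le_zero hconv ha).1 hmin, fun w hw => ?_⟩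
  rw [hmin]
  exact ciInf_le ⟨0, Set.forall_mem_range.2 fun _ => norm_nonneg _⟩ (⟨w, hw⟩ : A)

/-- Stability of nearest points under perturbation of the point and of the convex set. -/
theorem norm_nearest_sub_sq_le {p q a b a' b' : E} {η : ℝ}
    (h1 : inner ℝ (p - a) (b' - a) ≤ 0) (h2 : inner ℝ (q - b) (a' - b) ≤ 0)
    (hb : ‖b - b'‖ ≤ η) (ha : ‖a - a'‖ ≤ η) :
    ‖a - b‖ ^ 2 ≤ ‖p - q‖ * ‖a - b‖ + η * (‖p - a‖ + ‖q - b‖) := by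
  -- Each nearest point is tested against an approximation, in its own set, of the other one; the
  -- sum of the two inequalities gives the bound.
  have e1 : inner ℝ (p - a) (b - a) = inner ℝ (p - a) (b' - a) + inner ℝ (p - a) (b - b') := by
    rw [← inner_add_right]; congr 1; abel
  have e2 : inner ℝ (q - b) (a - b) = inner ℝ (q - b) (a' - b) + inner ℝ (q - b) (a - a') := by
    rw [← inner_add_right]; congr 1; abel
  have e3 : inner ℝ (p - a) (b - a) + inner ℝ (q - b) (a - b)
      = ‖a - b‖ ^ 2 - inner ℝ (p - q) (a - b) := by
    rw [← real_inner_self_eq_norm_sq]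
    simp only [inner_sub_left, inner_sub_right, real_inner_comm]
    ring
  have i1 := (real_inner_le_norm (p - a) (b - b')).trans
    (mul_le_mul_of_nonneg_left hb (norm_nonneg _))
  have i2 := (real_inner_le_norm (q - b) (a - a')).trans
    (mul_le_mul_of_nonneg_left ha (norm_nonneg _))
  have i3 := real_inner_le_norm (p - q) (a - b)
  linarith

/-- The nearest-point selection of a Lipschitz convex-valued map along a curve is continuous. -/
theorem exists_continuous_nearest_selection {X : Type*} [TopologicalSpace X] {G : E → Set E}
    {L M : ℝ} (hL : 0 ≤ L) (Y v : C(X, E)) (hne : ∀ t, (G (Y t)).Nonempty)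
    (hconv : ∀ t, Convex ℝ (G (Y t))) (hcomp : ∀ t, IsCompact (G (Y t)))
    (hlip : ∀ t t', ∀ u ∈ G (Y t), ∃ w ∈ G (Y t'), ‖u - w‖ ≤ L * ‖Y t - Y t'‖)
    (hM : ∀ t, ∀ u ∈ G (Y t), ‖u‖ ≤ M) (hv : ∀ t, ‖v t‖ ≤ M) :
    ∃ w : C(X, E), ∀ t, w t ∈ G (Y t) ∧ ∀ u ∈ G (Y t), ‖v t - w t‖ ≤ ‖v t - u‖ := by
  choose w hw hproj hmin using fun t => exists_nearest_point (hne t) (hcomp t) (hconv t) (v t)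
  have hcont : Continuous w := by
    rw [continuous_iff_continuousAt]
    intro t₀
    have hbd : ∀ t, ‖w t - w t₀‖ ^ 2 ≤
        ‖v t - v t₀‖ * (2 * M) + (L * ‖Y t - Y t₀‖) * (4 * M) := fun t => by
      obtain ⟨a', ha', haa⟩ := hlip t t₀ (w t) (hw t)
      obtain ⟨b', hb', hbb⟩ := hlip t₀ t (w t₀) (hw t₀)
      rw [norm_sub_rev (Y t₀)] at hbb
      refine (norm_nearest_sub_sq_le (hproj t b' hb') (hproj t₀ a' ha') hbb haa).trans ?_
      have n1 := hM t _ (hw t)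
      have n2 := hM t₀ _ (hw t₀)
      have n3 := hv t
      have n4 := hv t₀
      have m1 := norm_sub_le (w t) (w t₀)
      have m2 := norm_sub_le (v t) (w t)
      have m3 := norm_sub_le (v t₀) (w t₀)
      gcongr <;> linarith
    rw [ContinuousAt, tendsto_iff_norm_sub_tendsto_zero]
    have hlim : Filter.Tendsto (fun t => ‖v t - v t₀‖ * (2 * M) + (L * ‖Y t - Y t₀‖) * (4 * M))
        (nhds t₀) (nhds 0) := by
      have : Continuous fun t => ‖v t - v t₀‖ * (2 * M) + (L * ‖Y t - Y t₀‖) * (4 * M) := by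
        fun_prop
      simpa using this.tendsto t₀
    have hsq := squeeze_zero (fun t => sq_nonneg ‖w t - w t₀‖) hbd hlim
    simpa using hsq.sqrt
  exact ⟨⟨w, hcont⟩, fun t => ⟨hw t, hmin t⟩⟩

/-- The primitive starting at `y` of a curve of velocities on `[0, s]`. -/
noncomputable def primitive {s : ℝ} (hs : 0 ≤ s) (y : E) (v : C(Icc (0 : ℝ) s, E)) (t : ℝ) : E :=
  y + ∫ u in (0 : ℝ)..t, IccExtend hs v u

theorem norm_primitive_sub_le {s : ℝ} (hs : 0 ≤ s) (y : E) {v : C(Icc (0 : ℝ) s, E)} {M : ℝ}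
    (hv : ∀ t, ‖v t‖ ≤ M) {t : ℝ} (ht : t ∈ Icc 0 s) : ‖primitive hs y v t - y‖ ≤ M * s := by
  have h := intervalIntegral.norm_integral_le_of_norm_le_const (a := 0) (b := t)
    (f := IccExtend hs v) (C := M) fun u _ => hv _
  rw [sub_zero, abs_of_nonneg ht.1] at h
  have hM : 0 ≤ M := (norm_nonneg _).trans (hv ⟨t, ht⟩)
  simpa [primitive] using h.trans (mul_le_mul_of_nonneg_left ht.2 hM)

theorem norm_primitive_sub_primitive_le {s : ℝ} (hs : 0 ≤ s) (y : E) (v w : C(Icc (0 : ℝ) s, E))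
    {t : ℝ} (ht : t ∈ Icc 0 s) :
    ‖primitive hs y v t - primitive hs y w t‖ ≤ dist v w * s := by
  have h := norm_primitive_sub_le hs 0 (v := v - w) (M := dist v w)
    (fun t => by rw [dist_eq_norm]; exact (v - w).norm_coe_le_norm t) ht
  have e : primitive hs 0 (v - w) t - 0 = primitive hs y v t - primitive hs y w t := by
    have : IccExtend hs (v - w) = fun u => IccExtend hs v u - IccExtend hs w u := rfl
    simp only [primitive, this]
    rw [intervalIntegral.integral_sub (v.continuous.Icc_extend'.intervalIntegrable _ _)
      (w.continuous.Icc_extend'.intervalIntegrable _ _)]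
    abel
  rwa [e] at h

variable [CompleteSpace E]

theorem hasDerivAt_primitive {s : ℝ} (hs : 0 ≤ s) (y : E) (v : C(Icc (0 : ℝ) s, E)) (t : ℝ) :
    HasDerivAt (primitive hs y v) (IccExtend hs v t) t :=
  ((v.continuous.Icc_extend' (h := hs)).integral_hasStrictDerivAt 0 t).hasDerivAt.const_add y

/-- **Filippov's theorem** near a point: from every nearby initial point there is a short `C¹`
solution of the differential inclusion whose velocity is almost a given admissible one. -/
theorem exists_solution_near_velocity {G : E → Set E} {x y v₀ : E} {L M s : ℝ} (hL : 0 ≤ L)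
    (hne : ∀ z, (G z).Nonempty) (hconv : ∀ z, Convex ℝ (G z)) (hcomp : ∀ z, IsCompact (G z))
    (hlip : ∀ a ∈ Metric.closedBall x 1, ∀ b ∈ Metric.closedBall x 1,
      ∀ u ∈ G a, ∃ w ∈ G b, ‖u - w‖ ≤ L * ‖a - b‖)
    (hM : ∀ a ∈ Metric.closedBall x 1, ∀ u ∈ G a, ‖u‖ ≤ M)
    (hs : 0 ≤ s) (hsL : L * s ≤ 1 / 2) (hy : ‖y - x‖ + M * s ≤ 1) (hv₀ : v₀ ∈ G x) :
    ∃ f f' : ℝ → E, f 0 = y ∧ Continuous f' ∧ (∀ t, HasDerivAt f (f' t) t) ∧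
      (∀ t ∈ Icc 0 s, f' t ∈ G (f t)) ∧
      ∀ t ∈ Icc 0 s, ‖f' t - v₀‖ ≤ 2 * (L * (‖y - x‖ + M * s)) := by
  have hball : ∀ v : C(Icc (0 : ℝ) s, E), (∀ t, ‖v t‖ ≤ M) → ∀ t ∈ Icc 0 s,
      ‖primitive hs y v t - x‖ ≤ ‖y - x‖ + M * s := fun v hv t ht => by
    have h1 := norm_primitive_sub_le hs y hv ht
    have h2 := norm_sub_le_norm_sub_add_norm_sub (primitive hs y v t) y x
    linarith
  have hmem : ∀ v : C(Icc (0 : ℝ) s, E), (∀ t, ‖v t‖ ≤ M) → ∀ t ∈ Icc 0 s,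
      primitive hs y v t ∈ Metric.closedBall x 1 := fun v hv t ht => by
    rw [mem_closedBall_iff_norm]
    exact (hball v hv t ht).trans hy
  have hxx : x ∈ Metric.closedBall x 1 := Metric.mem_closedBall_self zero_le_one
  -- Picard iteration on velocities: `Φ` replaces `v` by its nearest-point selection in `G` along
  -- the primitive of `v`. The bound `M` keeps all primitives in the ball where `G` is Lipschitz.
  let S := {v : C(Icc (0 : ℝ) s, E) // ∀ t, ‖v t‖ ≤ M}
  have hstep : ∀ v : S, ∃ w : S, ∀ t : Icc (0 : ℝ) s, w.1 t ∈ G (primitive hs y v.1 t) ∧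
      ∀ u ∈ G (primitive hs y v.1 t), ‖v.1 t - w.1 t‖ ≤ ‖v.1 t - u‖ := fun v => by
    have hYc : Continuous fun t : Icc (0 : ℝ) s => primitive hs y v.1 t :=
      (continuous_iff_continuousAt.2 fun t =>
        (hasDerivAt_primitive hs y v.1 t).continuousAt).comp continuous_subtype_val
    obtain ⟨w, hw⟩ := exists_continuous_nearest_selection (G := G) (M := M) hL ⟨_, hYc⟩ v.1
      (fun t => hne _) (fun t => hconv _) (fun t => hcomp _)
      (fun t t' u hu => hlip _ (hmem v.1 v.2 t t.2) _ (hmem v.1 v.2 t' t'.2) u hu)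
      (fun t u hu => hM _ (hmem v.1 v.2 t t.2) u hu) v.2
    exact ⟨⟨w, fun t => hM _ (hmem v.1 v.2 t t.2) _ (hw t).1⟩, hw⟩
  choose Φ hΦ hΦmin using hstep
  let u₀ : S := ⟨ContinuousMap.const _ v₀, fun t => hM x hxx v₀ hv₀⟩
  let u : ℕ → S := fun k => Φ^[k] u₀
  have hsucc : ∀ k, u (k + 1) = Φ (u k) := fun k => Function.iterate_succ_apply' Φ k u₀
  set D := L * (‖y - x‖ + M * s) with hD
  have hM0 : 0 ≤ M := (norm_nonneg _).trans (hM x hxx v₀ hv₀)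
  have hD0 : 0 ≤ D := by positivity
  -- The first gap is at most `D`, because `v₀ ∈ G x` and the first curve stays within `‖y - x‖ + M
  -- * s` of `x`. Later gaps shrink by `L * s ≤ 1 / 2`, so the total is at most `2 * D`.
  have hgeom : ∀ k, dist (u k).1 (u (k + 1)).1 ≤ D * (1 / 2) ^ k := by
    intro k
    induction k with
    | zero =>
      rw [pow_zero, mul_one, ContinuousMap.dist_le hD0]
      intro t
      obtain ⟨w, hw, hwle⟩ := hlip x hxx _ (hmem u₀.1 u₀.2 t t.2) v₀ hv₀
      rw [hsucc, dist_eq_norm]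
      refine (hΦmin _ t w hw).trans (hwle.trans ?_)
      rw [norm_sub_rev]
      exact mul_le_mul_of_nonneg_left (hball u₀.1 u₀.2 t t.2) hL
    | succ k ih =>
      rw [ContinuousMap.dist_le (by positivity)]
      intro t
      obtain ⟨w, hw, hwle⟩ := hlip _ (hmem _ (u k).2 t t.2) _ (hmem _ (u (k + 1)).2 t t.2)
        ((u (k + 1)).1 t) (by rw [hsucc]; exact hΦ _ t)
      rw [hsucc (k + 1), dist_eq_norm]
      refine (hΦmin _ t w hw).trans (hwle.trans ?_)
      have h1 := norm_primitive_sub_primitive_le hs y (u k).1 (u (k + 1)).1 t.2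
      calc L * _ ≤ L * (dist (u k).1 (u (k + 1)).1 * s) := mul_le_mul_of_nonneg_left h1 hL
        _ = (L * s) * dist (u k).1 (u (k + 1)).1 := by ring
        _ ≤ 1 / 2 * (D * (1 / 2) ^ k) := mul_le_mul hsL ih dist_nonneg (by norm_num)
        _ = D * (1 / 2) ^ (k + 1) := by ring
  obtain ⟨w, hw⟩ := cauchySeq_tendsto_of_complete
    (cauchySeq_of_le_geometric (1 / 2) D (by norm_num) hgeom)
  have hdist := dist_le_of_le_geometric_of_tendsto₀ (1 / 2) D (by norm_num) hgeom hw
  have hpt : ∀ t, Filter.Tendsto (fun k => (u k).1 t) Filter.atTop (nhds (w t)) := fun t =>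
    ((continuous_eval_const t).tendsto w).comp hw
  have hwM : ∀ t, ‖w t‖ ≤ M := fun t =>
    le_of_tendsto (hpt t).norm (Filter.Eventually.of_forall fun k => (u k).2 t)
  have hmemG : ∀ t : Icc (0 : ℝ) s, w t ∈ G (primitive hs y w t) := fun t => by
    have hex : ∀ k, ∃ z ∈ G (primitive hs y w t),
        ‖(u (k + 1)).1 t - z‖ ≤ L * (dist (u k).1 w * s) := fun k => by
      obtain ⟨z, hz, hzle⟩ := hlip _ (hmem _ (u k).2 t t.2) _ (hmem _ hwM t t.2)
        ((u (k + 1)).1 t) (by rw [hsucc]; exact hΦ _ t)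
      exact ⟨z, hz, hzle.trans (mul_le_mul_of_nonneg_left
        (norm_primitive_sub_primitive_le hs y _ _ t.2) hL)⟩
    choose z hz hzle using hex
    have h0 : Filter.Tendsto (fun k => L * (dist (u k).1 w * s)) Filter.atTop (nhds 0) := by
      simpa using ((tendsto_iff_dist_tendsto_zero.1 hw).mul_const s).const_mul L
    have h1 : Filter.Tendsto (fun k => (u (k + 1)).1 t - z k) Filter.atTop (nhds 0) :=
      squeeze_zero_norm hzle h0
    have h2 := ((hpt t).comp (Filter.tendsto_add_atTop_nat 1)).sub h1
    rw [← (hcomp _).isClosed.closure_eq]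
    exact mem_closure_of_tendsto (by simpa [Function.comp_def] using h2)
      (Filter.Eventually.of_forall hz)
  refine ⟨primitive hs y w, IccExtend hs w, by simp [primitive],
    w.continuous.Icc_extend', hasDerivAt_primitive hs y w, fun t ht => ?_, fun t ht => ?_⟩
  · rw [IccExtend_of_mem hs w ht]
    exact hmemG ⟨t, ht⟩
  · rw [IccExtend_of_mem hs w ht, ← dist_eq_norm, dist_comm]
    have := (ContinuousMap.dist_apply_le_dist (f := (u 0).1) (g := w) ⟨t, ht⟩).trans hdist
    have e : (u 0).1 ⟨t, ht⟩ = v₀ := rfl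
    rw [e] at this
    exact this.trans_eq (by ring)

end Filippov

end MinTime

/-! ### Moving along the dynamics near a point. -/

namespace MinTime

variable {n : ℕ}

theorem AssumptionF.exists_local_bounds
    {F : EuclideanSpace ℝ (Fin n) → Set (EuclideanSpace ℝ (Fin n))} (hF : AssumptionF F)
    (x : EuclideanSpace ℝ (Fin n)) :
    ∃ L M δ : ℝ, 0 < L ∧ 0 < M ∧ 0 < δ ∧ L * δ ≤ 1 / 2 ∧ δ + M * δ ≤ 1 ∧
      (∀ a ∈ Metric.closedBall x 1, ∀ b ∈ Metric.closedBall x 1,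
        ∀ u ∈ F a, ∃ w ∈ F b, ‖u - w‖ ≤ L * ‖a - b‖) ∧
      (∀ a ∈ Metric.closedBall x 1, ∀ u ∈ F a, ‖u‖ ≤ M) ∧
      ∀ y T z τ, IsTrajectory F T y z → ‖y - x‖ ≤ δ → 0 ≤ τ → τ ≤ T → τ ≤ δ →
        ∀ t ∈ Icc 0 τ, ‖z t - y‖ ≤ M * τ := by
  obtain ⟨L, hL, hlip⟩ := hF.locally_lipschitz _ (isCompact_closedBall x 1)
  obtain ⟨γ, hγ, hgr⟩ := hF.linear_growth
  set M := 2 * (γ * (2 + ‖x‖)) with hMdef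
  have hM : 0 < M := by positivity
  have hle : 0 < 2 * L + 2 * γ + 1 + M := by positivity
  have hδ : ∀ c, 0 ≤ c → c ≤ 2 * L + 2 * γ + 1 + M →
      c * (1 / (2 * L + 2 * γ + 1 + M)) ≤ 1 := fun c _ hc => by
    rw [mul_one_div]; exact (div_le_one hle).2 hc
  have hδ1 := hδ 1 zero_le_one (by linarith)
  -- Each smallness condition has the form `c * δ ≤ 1` with `c` at most this denominator.
  refine ⟨L, M, 1 / (2 * L + 2 * γ + 1 + M), hL, hM, by positivity, ?_, ?_, ?_, ?_, ?_⟩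
  · linarith [hδ (2 * L) (by positivity) (by linarith)]
  · linarith [hδ (1 + M) (by positivity) (by linarith)]
  · intro a ha b hb u hu
    obtain ⟨w, hw, d, hd, rfl⟩ := hlip a ha b hb hu
    obtain ⟨e, he, rfl⟩ := hd
    refine ⟨w, hw, ?_⟩
    rw [mem_closedBall_zero_iff] at he
    simp only [add_sub_cancel_left, norm_smul, norm_mul, abs_norm, Real.norm_eq_abs,
      abs_of_pos hL]
    rw [norm_sub_rev a b]
    exact mul_le_of_le_one_right (by positivity) he
  · intro a ha u hu
    rw [mem_closedBall_iff_norm] at ha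
    have h1 : ‖a‖ ≤ ‖x‖ + ‖a - x‖ := by simpa using norm_add_le x (a - x)
    have h2 : γ * (1 + ‖a‖) ≤ γ * (2 + ‖x‖) := mul_le_mul_of_nonneg_left (by linarith) hγ.le
    have := hgr a u hu
    have : 0 < γ * (2 + ‖x‖) := by positivity
    linarith
  · intro y T z τ hz hy hτ hτT hτδ t ht
    have h1 : ‖y‖ ≤ ‖x‖ + ‖y - x‖ := by simpa using norm_add_le x (y - x)
    refine (hz.norm_sub_le_of_growth hγ hgr hτ hτT ?_ t ht).trans ?_
    · have := mul_le_mul_of_nonneg_right hτδ hγ.le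
      linarith [hδ (2 * γ) (by positivity) (by linarith)]
    · have h2 : γ * (1 + ‖y‖) ≤ γ * (2 + ‖x‖) := mul_le_mul_of_nonneg_left (by linarith) hγ.le
      calc _ ≤ 2 * τ * (γ * (2 + ‖x‖)) := mul_le_mul_of_nonneg_left h2 (by positivity)
        _ = M * τ := by rw [hMdef]; ring

/-- Following a near-optimal trajectory forwards lowers the minimum time at unit speed, while the
displacement in direction `ζ` is at least what the minimized Hamiltonian allows. -/
theorem AssumptionF.exists_forward
    {F : EuclideanSpace ℝ (Fin n) → Set (EuclideanSpace ℝ (Fin n))} (hF : AssumptionF F)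
    (K : Set (EuclideanSpace ℝ (Fin n))) {x ζ : EuclideanSpace ℝ (Fin n)} {h : ℝ}
    (hh : ∀ v ∈ F x, h ≤ inner ℝ ζ v) :
    ∃ C δ : ℝ, 0 < C ∧ 0 < δ ∧ ∀ y, ‖y - x‖ ≤ δ → ∀ s, 0 ≤ s → s ≤ δ → ∀ β ε : ℝ, 0 ≤ β → 0 < ε →
      minTime F K y ≤ ENNReal.ofReal β →
      ∃ τ w, 0 ≤ τ ∧ τ ≤ s ∧ (y ∉ K → 0 < s → 0 < τ) ∧
        minTime F K w ≤ ENNReal.ofReal (β + ε - s) ∧ (s < β + ε ∨ w ∈ K) ∧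
        ‖w - y‖ ≤ C * τ ∧ τ * h - C * τ * (‖y - x‖ + s) ≤ inner ℝ ζ (w - y) := by
  obtain ⟨L, M, δ, hL, hM, hδ, -, hMδ, hlip, -, hclose⟩ := hF.exists_local_bounds x
  refine ⟨M + ‖ζ‖ * L * (1 + M), δ, by positivity, hδ, fun y hy s hs hsδ β ε hβ hε hT => ?_⟩
  obtain ⟨T, z, hT0, hTlt, hz, hzK, hTpos⟩ := exists_isTrajectory_of_minTime_lt
    (hT.trans_lt ((ENNReal.ofReal_lt_ofReal_iff (by linarith)).2 (show β < β + ε by linarith)))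
  -- The motion stops at time `T` if the target is reached before time `s`.
  have hτ0 : 0 ≤ min s T := le_min hs hT0
  have hτs : min s T ≤ s := min_le_left s T
  have hτT : min s T ≤ T := min_le_right s T
  have hcl := hclose y T z (min s T) hz hy hτ0 hτT (hτs.trans hsδ)
  refine ⟨min s T, z (min s T), hτ0, hτs, fun h1 h2 => lt_min h2 (hTpos h1), ?_, ?_, ?_, ?_⟩
  · refine (minTime_le_of_isTrajectory (sub_nonneg.2 hτT) (hz.tail hτ0 hτT) (by simpa)).trans ?_
    rcases le_total s T with hsT | hTs
    · rw [min_eq_left hsT]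
      exact ENNReal.ofReal_le_ofReal (by linarith)
    · simp [min_eq_right hTs]
  · rcases le_total s T with hsT | hTs
    · exact Or.inl (by linarith)
    · rw [min_eq_right hTs]
      exact Or.inr hzK
  · refine (hcl _ (right_mem_Icc.2 hτ0)).trans (mul_le_mul_of_nonneg_right ?_ hτ0)
    have : 0 ≤ ‖ζ‖ * L * (1 + M) := by positivity
    linarith
  · have hMs : M * min s T ≤ M * s := mul_le_mul_of_nonneg_left hτs hM.le
    have hMδ' : M * s ≤ M * δ := mul_le_mul_of_nonneg_left hsδ hM.le
    -- Velocities along `z` are within `L * (‖y - x‖ + M * s)` of `F x`, where `h` is a lower bound.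
    have key := hz.mul_le_inner (ζ := ζ) (c := h - ‖ζ‖ * (L * (‖y - x‖ + M * s))) hτ0 hτT
      (fun t ht v hv => by
        have h1 := hcl t ht
        have h2 := norm_sub_le_norm_sub_add_norm_sub (z t) y x
        have hzx : ‖z t - x‖ ≤ ‖y - x‖ + M * s := by linarith
        obtain ⟨u, hu, hvu⟩ := hlip (z t) (by rw [mem_closedBall_iff_norm]; linarith) x
          (Metric.mem_closedBall_self zero_le_one) v hv
        have h3 := real_inner_le_norm ζ (u - v)
        rw [norm_sub_rev, inner_sub_right] at h3
        have h4 := mul_le_mul_of_nonneg_left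
          (hvu.trans (mul_le_mul_of_nonneg_left hzx hL.le)) (norm_nonneg ζ)
        linarith [hh u hu])
    refine le_trans ?_ key
    have h5 : ‖ζ‖ * (L * (‖y - x‖ + M * s)) ≤
        (M + ‖ζ‖ * L * (1 + M)) * (‖y - x‖ + s) := by
      have p1 : 0 ≤ ‖ζ‖ * L * s := by positivity
      have p2 : 0 ≤ ‖ζ‖ * L * M * ‖y - x‖ := by positivity
      have p3 : 0 ≤ M * (‖y - x‖ + s) := by positivity
      linarith
    have h6 := mul_le_mul_of_nonneg_left h5 hτ0
    linarith

/-- Following the dynamics backwards raises the minimum time at most at unit speed, and the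
backward velocity can be chosen close to any given velocity at `x`. -/
theorem AssumptionF.exists_backward
    {F : EuclideanSpace ℝ (Fin n) → Set (EuclideanSpace ℝ (Fin n))} (hF : AssumptionF F)
    (K : Set (EuclideanSpace ℝ (Fin n))) (x : EuclideanSpace ℝ (Fin n)) :
    ∃ C δ : ℝ, 0 < C ∧ 0 < δ ∧ ∀ y, ‖y - x‖ ≤ δ → ∀ s, 0 ≤ s → s ≤ δ → ∀ v ∈ F x, ∀ β : ℝ, 0 ≤ β →
      minTime F K y ≤ ENNReal.ofReal β →
      ∃ w, minTime F K w ≤ ENNReal.ofReal (β + s) ∧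
        ‖w - (y - s • v)‖ ≤ C * s * (‖y - x‖ + s) := by
  obtain ⟨L, M, δ, hL, hM, hδ, hLδ, hMδ, hlip, hMbd, -⟩ := hF.exists_local_bounds x
  refine ⟨2 * L * (1 + M), δ, by positivity, hδ, fun y hy s hs hsδ v hv β hβ hT => ?_⟩
  have hMs : M * s ≤ M * δ := mul_le_mul_of_nonneg_left hsδ hM.le
  -- A solution of the reversed inclusion from `y` with velocity near `-v`, run backwards, is a
  -- trajectory from `f s` to `y`.
  obtain ⟨f, f', hf0, hf'c, hf, hfG, hfv⟩ := exists_solution_near_velocity (G := fun z => -F z)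
    (x := x) (y := y) (v₀ := -v) (L := L) (M := M) (s := s) hL.le
    (fun z => (hF.nonempty z).neg) (fun z => (hF.convex z).neg) (fun z => (hF.compact z).neg)
    (fun a ha b hb u hu => by
      obtain ⟨w, hw, hle⟩ := hlip a ha b hb (-u) hu
      refine ⟨-w, by simpa using hw, ?_⟩
      rwa [show u - -w = -(-u - w) by abel, norm_neg])
    (fun a ha u hu => by simpa using hMbd a ha (-u) hu) hs
    ((mul_le_mul_of_nonneg_left hsδ hL.le).trans hLδ) (by linarith) (by simpa using hv)
  have htraj : IsTrajectory F s (f s) (fun t => f (s - t)) :=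
    { absolutelyContinuous := by
        refine ContDiffOn.absolutelyContinuousOnInterval (ContDiff.contDiffOn ?_)
        have hfc : ContDiff ℝ 1 f := contDiff_one_iff_deriv.2
          ⟨fun t => (hf t).differentiableAt, by rwa [funext fun t => (hf t).deriv]⟩
        exact hfc.comp (contDiff_const.sub contDiff_id)
      init := by simp
      inclusion := by
        refine (ae_restrict_iff' measurableSet_Icc).2 (Filter.Eventually.of_forall fun t ht => ?_)
        refine ⟨-f' (s - t), ?_, ?_⟩
        · simpa using hfG (s - t) ⟨by linarith [ht.2], by linarith [ht.1]⟩
        · exact (hf (s - t)).comp_const_sub s t }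
  refine ⟨f s, ?_, ?_⟩
  · refine ENNReal.le_of_forall_pos_le_add fun ε hε _ => ?_
    obtain ⟨T, z, hT0, hTlt, hz, hzK, -⟩ := exists_isTrajectory_of_minTime_lt
      (hT.trans_lt ((ENNReal.ofReal_lt_ofReal_iff (by positivity)).2
        (show β < β + ε by simpa using hε)))
    have hz' : IsTrajectory F T (f (s - s)) z := by simpa [hf0] using hz
    have hcat := htraj.concat hs hT0 hz'
    refine (minTime_le_of_isTrajectory (add_nonneg hs hT0) hcat ?_).trans ?_
    · simpa [hT0, hf0] using hzK
    · rw [← ENNReal.ofReal_coe_nnreal, ← ENNReal.ofReal_add (by positivity) (by positivity)]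
      exact ENNReal.ofReal_le_ofReal (by linarith)
  · have hmv := Convex.norm_image_sub_le_of_norm_hasDerivWithin_le
      (f := fun t => f t + t • v) (f' := fun t => f' t + (1 : ℝ) • v) (s := Icc 0 s)
      (C := 2 * (L * (‖y - x‖ + M * s))) (x := 0) (y := s)
      (fun t _ => ((hf t).add ((hasDerivAt_id t).smul_const v)).hasDerivWithinAt)
      (fun t ht => by simpa using hfv t ht) (convex_Icc 0 s) (left_mem_Icc.2 hs)
      (right_mem_Icc.2 hs)
    have e : f s + s • v - (f 0 + (0 : ℝ) • v) = f s - (y - s • v) := by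
      rw [hf0]; simp; abel
    rw [e, sub_zero, Real.norm_of_nonneg hs] at hmv
    refine hmv.trans ?_
    have p1 : 0 ≤ L * s * s := by positivity
    have p2 : 0 ≤ L * s * M * ‖y - x‖ := by positivity
    linarith

end MinTime

/-! ### Convex cones and linear images. -/

namespace MinTime

section ConvexCone

variable {E : Type*} [NormedAddCommGroup E] [InnerProductSpace ℝ E] {K : Set E} {x : E}

theorem zero_mem_proxNormalCone : (0 : E) ∈ proxNormalCone K x :=
  ⟨0, le_rfl, fun y _ => by simp⟩

theorem add_mem_proxNormalCone {v w : E} (hv : v ∈ proxNormalCone K x)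
    (hw : w ∈ proxNormalCone K x) : v + w ∈ proxNormalCone K x := by
  obtain ⟨σ, hσ, h⟩ := hv
  obtain ⟨σ', hσ', h'⟩ := hw
  refine ⟨σ + σ', add_nonneg hσ hσ', fun y hy => ?_⟩
  rw [inner_add_left, add_mul]
  exact add_le_add (h y hy) (h' y hy)

theorem smul_mem_proxNormalCone {v : E} {c : ℝ} (hc : 0 ≤ c) (hv : v ∈ proxNormalCone K x) :
    c • v ∈ proxNormalCone K x := by
  obtain ⟨σ, hσ, h⟩ := hv
  refine ⟨c * σ, mul_nonneg hc hσ, fun y hy => ?_⟩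
  rw [real_inner_smul_left, mul_assoc]
  exact mul_le_mul_of_nonneg_left (h y hy) hc

/-- The proximal normal inequality only has to be checked near the base point. -/
theorem mem_proxNormalCone_of_local {v : E} {σ δ : ℝ} (hσ : 0 ≤ σ) (hδ : 0 < δ)
    (h : ∀ y ∈ K, ‖y - x‖ ≤ δ → inner ℝ v (y - x) ≤ σ * ‖y - x‖ ^ 2) :
    v ∈ proxNormalCone K x := by
  refine ⟨σ + ‖v‖ / δ, by positivity, fun y hy => ?_⟩
  rcases le_total ‖y - x‖ δ with hle | hge
  · refine (h y hy hle).trans ?_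
    gcongr
    have : 0 ≤ ‖v‖ / δ := by positivity
    linarith
  · have h1 : 1 ≤ ‖y - x‖ / δ := (one_le_div hδ).2 hge
    calc inner ℝ v (y - x) ≤ ‖v‖ * ‖y - x‖ := real_inner_le_norm _ _
      _ ≤ ‖v‖ * ‖y - x‖ * (‖y - x‖ / δ) := le_mul_of_one_le_right (by positivity) h1
      _ = ‖v‖ / δ * ‖y - x‖ ^ 2 := by ring
      _ ≤ (σ + ‖v‖ / δ) * ‖y - x‖ ^ 2 := by gcongr; linarith

/-- The elements of the linear span of a convex cone are differences of its elements. -/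
theorem exists_sub_of_mem_span {V : Type*} [AddCommGroup V] [Module ℝ V] {C : Set V}
    (h0 : (0 : V) ∈ C) (hadd : ∀ v ∈ C, ∀ w ∈ C, v + w ∈ C)
    (hsmul : ∀ c : ℝ, 0 ≤ c → ∀ v ∈ C, c • v ∈ C) {u : V} (hu : u ∈ Submodule.span ℝ C) :
    ∃ p ∈ C, ∃ q ∈ C, u = p - q := by
  induction hu using Submodule.span_induction with
  | mem u hu => exact ⟨u, hu, 0, h0, by simp⟩
  | zero => exact ⟨0, h0, 0, h0, by simp⟩
  | add u w _ _ hu hw =>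
    obtain ⟨p, hp, q, hq, rfl⟩ := hu
    obtain ⟨p', hp', q', hq', rfl⟩ := hw
    exact ⟨p + p', hadd _ hp _ hp', q + q', hadd _ hq _ hq', by abel⟩
  | smul c u _ hu =>
    obtain ⟨p, hp, q, hq, rfl⟩ := hu
    rcases le_total 0 c with hc | hc
    · exact ⟨c • p, hsmul c hc _ hp, c • q, hsmul c hc _ hq, smul_sub _ _ _⟩
    · refine ⟨(-c) • q, hsmul _ (neg_nonneg.2 hc) _ hq, (-c) • p, hsmul _ (neg_nonneg.2 hc) _ hp, ?_⟩
      rw [neg_smul, neg_smul, smul_sub]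
      abel

/-- Injectivity on the span, not merely on `C`, keeps the images of independent generators
independent. -/
theorem coneHasDim_image_iff {V W : Type*} [AddCommGroup V] [Module ℝ V] [AddCommGroup W]
    [Module ℝ W] (f : V →ₗ[ℝ] W) {C : Set V} (hf : InjOn f (Submodule.span ℝ C)) (κ : ℕ) :
    ConeHasDim (f '' C) κ ↔ ConeHasDim C κ := by
  constructor
  · rintro ⟨a, ha, hli, hgen⟩
    choose d hd hda using ha
    have hfd : f ∘ d = a := funext hda
    refine ⟨d, hd, LinearIndependent.of_comp f (hfd ▸ hli), fun w hw => ?_⟩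
    obtain ⟨c, hc, hcw⟩ := hgen (f w) (mem_image_of_mem f hw)
    refine ⟨c, hc, hf (Submodule.subset_span hw) (Submodule.sum_mem _ fun i _ =>
      Submodule.smul_mem _ _ (Submodule.subset_span (hd i))) ?_⟩
    simp [hcw, hda]
  · rintro ⟨d, hd, hli, hgen⟩
    refine ⟨f ∘ d, fun i => mem_image_of_mem f (hd i), hli.map_injOn f (hf.mono ?_), ?_⟩
    · exact Submodule.span_mono (range_subset_iff.2 hd)
    · rintro _ ⟨w, hw, rfl⟩
      obtain ⟨c, hc, rfl⟩ := hgen w hw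
      exact ⟨c, hc, by simp⟩

theorem finrank_image_eq {V W : Type*} [AddCommGroup V] [Module ℝ V] [AddCommGroup W]
    [Module ℝ W] (f : V →ₗ[ℝ] W) {C : Set V} (hf : InjOn f (Submodule.span ℝ C)) :
    Set.finrank ℝ (f '' C) = Set.finrank ℝ C := by
  unfold Set.finrank
  rw [Submodule.span_image, ← LinearMap.range_domRestrict]
  exact LinearMap.finrank_range_of_inj (injOn_iff_injective.1 hf)

end ConvexCone

/-! ### The epigraph and the sign of the Hamiltonian. -/

variable {n : ℕ} {F : EuclideanSpace ℝ (Fin n) → Set (EuclideanSpace ℝ (Fin n))}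
  {K : Set (EuclideanSpace ℝ (Fin n))} {x ζ : EuclideanSpace ℝ (Fin n)} {r h : ℝ}

/-- The condition `0 ≤ p.snd` is needed since `ENNReal.ofReal` truncates negative heights to zero.
-/
theorem mem_epigraph_minTime_iff {p : WithLp 2 (EuclideanSpace ℝ (Fin n) × ℝ)} :
    p ∈ epigraph (fun y => ((minTime F K y : ℝ≥0∞) : EReal)) ↔
      0 ≤ p.snd ∧ minTime F K p.fst ≤ ENNReal.ofReal p.snd := by
  simp only [epigraph, mem_ofPred_eq]
  constructor
  · rintro ⟨-, h2⟩
    have h0 : (0 : ℝ) ≤ p.snd := EReal.coe_nonneg.1 ((EReal.coe_ennreal_nonneg _).trans h2)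
    refine ⟨h0, ?_⟩
    rwa [← EReal.coe_ennreal_le_coe_ennreal_iff, EReal.coe_ennreal_ofReal, max_eq_left h0]
  · rintro ⟨h0, h2⟩
    refine ⟨?_, ?_⟩
    · rw [← EReal.coe_ennreal_top, EReal.coe_ennreal_lt_coe_ennreal_iff]
      exact h2.trans_lt ENNReal.ofReal_lt_top
    · rwa [← EReal.coe_ennreal_le_coe_ennreal_iff, EReal.coe_ennreal_ofReal, max_eq_left h0] at h2

theorem inner_toLp_sub (p q z : WithLp 2 (EuclideanSpace ℝ (Fin n) × ℝ)) :
    inner ℝ p (q - z) = inner ℝ p.fst (q.fst - z.fst) + p.snd * (q.snd - z.snd) := by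
  rw [WithLp.prod_inner_apply]
  simp [mul_comm]

theorem norm_toLp_sub_sq (q z : WithLp 2 (EuclideanSpace ℝ (Fin n) × ℝ)) :
    ‖q - z‖ ^ 2 = ‖q.fst - z.fst‖ ^ 2 + (q.snd - z.snd) ^ 2 := by
  rw [WithLp.prod_norm_sq_eq_of_L2]
  simp

/-- Points off a closed target have positive minimum time. -/
theorem AssumptionF.minTime_pos (hF : AssumptionF F) (hK : IsClosed K) (hxK : x ∉ K) :
    0 < minTime F K x := by
  by_contra! h0
  obtain ⟨C, δ, hC, hδ, H⟩ := hF.exists_forward K (x := x) (ζ := 0) (h := 0) (by simp)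
  obtain ⟨ρ, hρ, hball⟩ := Metric.isOpen_iff.1 hK.isOpen_compl x hxK
  -- With `β = 0` and slack `ε = s`, the alternative `s < β + ε` fails, so a point of `K` lies
  -- within `ρ / 2` of `x`.
  have hs : 0 < min δ (ρ / (2 * C)) := by positivity
  obtain ⟨τ, w, hτ, hτs, -, -, hw, hwx, -⟩ := H x (by simpa using hδ.le) _ hs.le (min_le_left _ _)
    0 _ le_rfl hs (by simpa using h0)
  have hwK : w ∈ K := hw.resolve_left (by simp)
  refine hball (mem_ball_iff_norm.2 (hwx.trans_lt ?_)) hwK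
  have h1 : τ ≤ ρ / (2 * C) := hτs.trans (min_le_right _ _)
  have h2 : C * (ρ / (2 * C)) = ρ / 2 := by field_simp
  have := mul_le_mul_of_nonneg_left h1 hC.le
  linarith

/-- The minimized Hamiltonian is nonpositive on proximal normals to the sublevel set. -/
theorem AssumptionF.hamiltonian_nonpos (hF : AssumptionF F) (hxK : x ∉ K) (hr : 0 ≤ r)
    (hxr : minTime F K x = ENNReal.ofReal r) (hh : ∀ v ∈ F x, h ≤ inner ℝ ζ v)
    (hζ : ζ ∈ proxNormalCone (reachableWithin F K (minTime F K x)) x) : h ≤ 0 := by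
  obtain ⟨σ, hσ, hN⟩ := hζ
  obtain ⟨C, δ, hC, hδ, H⟩ := hF.exists_forward K hh
  -- Slack `ε = s` keeps the endpoint in the sublevel set; the inequality is then divided by `τ >
  -- 0`.
  have key : ∀ s, 0 < s → s ≤ δ → h ≤ (C + σ * C ^ 2) * s := fun s hs hsδ => by
    obtain ⟨τ, w, hτ0, hτs, hτpos, hw, -, hwx, hin⟩ := H x (by simpa using hδ.le) s hs.le hsδ
      r s hr hs hxr.le
    have hτ := hτpos hxK hs
    have h1 := hN w (by rw [add_sub_cancel_right, ← hxr] at hw; exact hw)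
    have h2 : ‖w - x‖ ^ 2 ≤ (C * τ) ^ 2 := by gcongr
    have h3 := mul_le_mul_of_nonneg_left h2 hσ
    rw [sub_self, norm_zero, zero_add] at hin
    have h4 : σ * C ^ 2 * τ * τ ≤ σ * C ^ 2 * τ * s := by gcongr
    refine le_of_mul_le_mul_left ?_ hτ
    linarith
  by_contra! hpos
  have hA : 0 < C + σ * C ^ 2 := by positivity
  have h1 := key (min δ (h / (2 * (C + σ * C ^ 2)))) (by positivity) (min_le_left _ _)
  have h2 := mul_le_mul_of_nonneg_left (min_le_right δ (h / (2 * (C + σ * C ^ 2)))) hA.le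
  have h3 : (C + σ * C ^ 2) * (h / (2 * (C + σ * C ^ 2))) = h / 2 := by field_simp
  linarith

end MinTime

/-! ### The epigraph cone as a graph over the sublevel cone. -/

namespace MinTime

variable {n : ℕ} {F : EuclideanSpace ℝ (Fin n) → Set (EuclideanSpace ℝ (Fin n))}
  {K : Set (EuclideanSpace ℝ (Fin n))} {x ζ : EuclideanSpace ℝ (Fin n)} {r h : ℝ}

/-- Proximal inequality at points of the epigraph above the level `r`. -/
theorem AssumptionF.exists_upper_estimate (hF : AssumptionF F) (hr : 0 ≤ r)
    (hxr : minTime F K x = ENNReal.ofReal r) (hh : ∀ v ∈ F x, h ≤ inner ℝ ζ v) (h0 : h ≤ 0)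
    (hζ : ζ ∈ proxNormalCone (reachableWithin F K (minTime F K x)) x) :
    ∃ A δ : ℝ, 0 ≤ A ∧ 0 < δ ∧ ∀ y, ‖y - x‖ ≤ δ → ∀ s, 0 ≤ s → s ≤ δ →
      minTime F K y ≤ ENNReal.ofReal (r + s) →
      inner ℝ ζ (y - x) + h * s ≤ A * (‖y - x‖ ^ 2 + s ^ 2) := by
  obtain ⟨σ, hσ, hN⟩ := hζ
  obtain ⟨C, δ, hC, hδ, H⟩ := hF.exists_forward K hh
  refine ⟨2 * σ * (1 + C ^ 2) + 2 * C, δ / 2, by positivity, by positivity,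
    fun y hy s hs hsδ hys => ?_⟩
  -- Moving for a time `t > s` leaves the positive slack `t - s` and lands at level `r`; afterwards
  -- `t` tends to `s`. As `h ≤ 0`, stopping early at `τ ≤ t` only helps.
  have key : ∀ t, s < t → t < δ →
      inner ℝ ζ (y - x) + h * t ≤ σ * (‖y - x‖ + C * t) ^ 2 + C * t * (‖y - x‖ + t) := by
    intro t hst htδ
    have ht : 0 ≤ t := hs.trans hst.le
    obtain ⟨τ, w, hτ0, hτt, -, hw, -, hwy, hin⟩ := H y (by linarith) t ht htδ.le (r + s) (t - s)
      (by linarith) (by linarith) hys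
    rw [show r + s + (t - s) - t = r by ring, ← hxr] at hw
    have h1 := hN w hw
    have h2 : ‖w - x‖ ≤ ‖y - x‖ + C * t := by
      have := norm_sub_le_norm_sub_add_norm_sub w y x
      have := mul_le_mul_of_nonneg_left hτt hC.le
      linarith
    have h3 : σ * ‖w - x‖ ^ 2 ≤ σ * (‖y - x‖ + C * t) ^ 2 := by gcongr
    have h4 : C * τ * (‖y - x‖ + t) ≤ C * t * (‖y - x‖ + t) := by gcongr
    have h5 : t * h ≤ τ * h := mul_le_mul_of_nonpos_right hτt h0
    have h6 : inner ℝ ζ (w - x) = inner ℝ ζ (w - y) + inner ℝ ζ (y - x) := by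
      rw [← inner_add_right]; congr 1; abel
    linarith
  have hlim : inner ℝ ζ (y - x) + h * s ≤
      σ * (‖y - x‖ + C * s) ^ 2 + C * s * (‖y - x‖ + s) := by
    have c1 : Continuous fun t : ℝ => inner ℝ ζ (y - x) + h * t := by fun_prop
    have c2 : Continuous fun t : ℝ =>
        σ * (‖y - x‖ + C * t) ^ 2 + C * t * (‖y - x‖ + t) := by fun_prop
    refine le_of_tendsto_of_tendsto ((c1.tendsto s).mono_left nhdsWithin_le_nhds)
      ((c2.tendsto s).mono_left (nhdsWithin_le_nhds (s := Ioi s))) ?_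
    filter_upwards [Ioo_mem_nhdsGT (show s < δ by linarith)] with t ht
    exact key t ht.1 ht.2
  refine hlim.trans ?_
  have q1 : (‖y - x‖ + C * s) ^ 2 ≤ 2 * (1 + C ^ 2) * (‖y - x‖ ^ 2 + s ^ 2) := by
    nlinarith [sq_nonneg (‖y - x‖ - C * s), sq_nonneg (C * ‖y - x‖)]
  have q2 : s * (‖y - x‖ + s) ≤ 2 * (‖y - x‖ ^ 2 + s ^ 2) := by
    nlinarith [sq_nonneg (‖y - x‖ - s)]
  have q3 := mul_le_mul_of_nonneg_left q1 hσ
  have q4 := mul_le_mul_of_nonneg_left q2 hC.le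
  linarith

/-- Proximal inequality at points of the epigraph below the level `r`. -/
theorem AssumptionF.exists_lower_estimate (hF : AssumptionF F)
    (hxr : minTime F K x = ENNReal.ofReal r) {v₀ : EuclideanSpace ℝ (Fin n)} (hv₀ : v₀ ∈ F x)
    (hζ : ζ ∈ proxNormalCone (reachableWithin F K (minTime F K x)) x) :
    ∃ A δ : ℝ, 0 ≤ A ∧ 0 < δ ∧ ∀ y, ‖y - x‖ ≤ δ → ∀ s, 0 ≤ s → s ≤ δ → s ≤ r →
      minTime F K y ≤ ENNReal.ofReal (r - s) →
      inner ℝ ζ (y - x) - inner ℝ ζ v₀ * s ≤ A * (‖y - x‖ ^ 2 + s ^ 2) := by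
  obtain ⟨σ, hσ, hN⟩ := hζ
  obtain ⟨C, δ, hC, hδ, H⟩ := hF.exists_backward K x
  set B := 1 + ‖v₀‖ + 2 * C * δ with hB
  have hB0 : 0 < B := by positivity
  refine ⟨2 * (σ * B ^ 2 + ‖ζ‖ * C), δ, by positivity, hδ, fun y hy s hs hsδ hsr hys => ?_⟩
  -- Moving backwards for time `s` from level `r - s` lands in the sublevel set, near `y - s • v₀`.
  obtain ⟨w, hw, hwy⟩ := H y hy s hs hsδ v₀ hv₀ (r - s) (by linarith) hys
  rw [sub_add_cancel, ← hxr] at hw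
  have h1 := hN w hw
  have h2 : ‖w - x‖ ≤ B * (‖y - x‖ + s) := by
    have e : w - x = (w - (y - s • v₀)) + ((y - x) - s • v₀) := by abel
    have n1 := norm_add_le (w - (y - s • v₀)) ((y - x) - s • v₀)
    have n2 := norm_sub_le (y - x) (s • v₀)
    rw [norm_smul, Real.norm_of_nonneg hs] at n2
    rw [e]
    have n3 : C * s * (‖y - x‖ + s) ≤ C * δ * (‖y - x‖ + s) := by gcongr
    have p1 : 0 ≤ ‖v₀‖ * ‖y - x‖ := by positivity
    have p2 : 0 ≤ C * δ * (‖y - x‖ + s) := by positivity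
    linarith
  have h3 : σ * ‖w - x‖ ^ 2 ≤ σ * (B * (‖y - x‖ + s)) ^ 2 := by gcongr
  have h4 := real_inner_le_norm ζ ((y - s • v₀) - w)
  rw [norm_sub_rev] at h4
  have h5 := mul_le_mul_of_nonneg_left hwy (norm_nonneg ζ)
  have h6 : inner ℝ ζ (y - x) - inner ℝ ζ v₀ * s
      = inner ℝ ζ (w - x) + inner ℝ ζ ((y - s • v₀) - w) := by
    simp only [inner_sub_right, real_inner_smul_right]; ring
  have q0 : (‖y - x‖ + s) ^ 2 ≤ 2 * (‖y - x‖ ^ 2 + s ^ 2) := add_sq_le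
  have q1 : s * (‖y - x‖ + s) ≤ (‖y - x‖ + s) ^ 2 := by
    have : 0 ≤ ‖y - x‖ * (‖y - x‖ + s) := by positivity
    linarith
  have q2 := mul_le_mul_of_nonneg_left q1 (show 0 ≤ ‖ζ‖ * C by positivity)
  have q3 := mul_le_mul_of_nonneg_left q0 (show 0 ≤ σ * B ^ 2 + ‖ζ‖ * C by positivity)
  linarith

/-- A proximal normal to the sublevel set lifts to one of the epigraph, its last coordinate being
the value of the minimized Hamiltonian. -/
theorem AssumptionF.toLp_mem_proxNormalCone_epigraph (hF : AssumptionF F) (hxK : x ∉ K)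
    (hr : 0 ≤ r) (hxr : minTime F K x = ENNReal.ofReal r) {v₀ : EuclideanSpace ℝ (Fin n)}
    (hv₀ : v₀ ∈ F x) (hmin : ∀ v ∈ F x, inner ℝ ζ v₀ ≤ inner ℝ ζ v)
    (hζ : ζ ∈ proxNormalCone (reachableWithin F K (minTime F K x)) x) :
    WithLp.toLp 2 (ζ, inner ℝ ζ v₀) ∈ proxNormalCone
      (epigraph (fun y => ((minTime F K y : ℝ≥0∞) : EReal))) (WithLp.toLp 2 (x, r)) := by
  have h0 := hF.hamiltonian_nonpos hxK hr hxr hmin hζ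
  obtain ⟨A, δ, hA, hδ, HA⟩ := hF.exists_upper_estimate hr hxr hmin h0 hζ
  obtain ⟨A', δ', hA', hδ', HA'⟩ := hF.exists_lower_estimate hxr hv₀ hζ
  refine mem_proxNormalCone_of_local (σ := A + A') (δ := min δ δ') (by positivity)
    (by positivity) fun p hp hpd => ?_
  obtain ⟨hp0, hpT⟩ := mem_epigraph_minTime_iff.1 hp
  have hsq := norm_toLp_sub_sq p (WithLp.toLp 2 (x, r))
  have hy : ‖p.fst - x‖ ≤ min δ δ' := by
    refine le_trans (abs_le_of_sq_le_sq' ?_ (norm_nonneg _)).2 hpd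
    rw [hsq]
    exact le_add_of_nonneg_right (sq_nonneg _)
  have hs : |p.snd - r| ≤ min δ δ' := by
    refine le_trans (abs_le_of_sq_le_sq ?_ (norm_nonneg _)) hpd
    rw [hsq]
    exact le_add_of_nonneg_left (sq_nonneg _)
  rw [inner_toLp_sub, hsq]
  change inner ℝ ζ (p.fst - x) + inner ℝ ζ v₀ * (p.snd - r) ≤
    (A + A') * (‖p.fst - x‖ ^ 2 + (p.snd - r) ^ 2)
  have hnn : 0 ≤ ‖p.fst - x‖ ^ 2 + (p.snd - r) ^ 2 := by positivity
  rw [add_mul]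
  rcases le_total r p.snd with hle | hle
  · have := HA p.fst (hy.trans (min_le_left _ _)) (p.snd - r) (sub_nonneg.2 hle)
      ((le_abs_self _).trans (hs.trans (min_le_left _ _))) (by simpa using hpT)
    linarith [mul_nonneg hA' hnn]
  · have := HA' p.fst (hy.trans (min_le_right _ _)) (r - p.snd) (sub_nonneg.2 hle)
      (by rw [abs_sub_comm] at hs; exact (le_abs_self _).trans (hs.trans (min_le_right _ _)))
      (by linarith) (by simpa using hpT)
    rw [show (r - p.snd) ^ 2 = (p.snd - r) ^ 2 by ring] at this
    linarith [mul_nonneg hA hnn]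

/-- The slice of the epigraph at height `r` is the sublevel set. -/
theorem fst_mem_proxNormalCone_reachableWithin (hr : 0 ≤ r)
    (hxr : minTime F K x = ENNReal.ofReal r) {p : WithLp 2 (EuclideanSpace ℝ (Fin n) × ℝ)}
    (hp : p ∈ proxNormalCone (epigraph (fun y => ((minTime F K y : ℝ≥0∞) : EReal)))
      (WithLp.toLp 2 (x, r))) :
    p.fst ∈ proxNormalCone (reachableWithin F K (minTime F K x)) x := by
  obtain ⟨σ, hσ, hN⟩ := hp
  refine ⟨σ, hσ, fun y hy => ?_⟩
  have := hN (WithLp.toLp 2 (y, r)) (mem_epigraph_minTime_iff.2 ⟨hr, hxr ▸ hy⟩)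
  rw [inner_toLp_sub, norm_toLp_sub_sq] at this
  simpa using this

/-- The last coordinate of a proximal normal to the epigraph is the value of the minimized
Hamiltonian at its first coordinate. -/
theorem AssumptionF.snd_eq_of_mem_proxNormalCone_epigraph (hF : AssumptionF F) (hxK : x ∉ K)
    (hr : 0 < r) (hxr : minTime F K x = ENNReal.ofReal r)
    {p : WithLp 2 (EuclideanSpace ℝ (Fin n) × ℝ)} {v₀ : EuclideanSpace ℝ (Fin n)}
    (hv₀ : v₀ ∈ F x) (hmin : ∀ v ∈ F x, inner ℝ p.fst v₀ ≤ inner ℝ p.fst v)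
    (hp : p ∈ proxNormalCone (epigraph (fun y => ((minTime F K y : ℝ≥0∞) : EReal)))
      (WithLp.toLp 2 (x, r))) :
    p.snd = inner ℝ p.fst v₀ := by
  have h0 := hF.hamiltonian_nonpos hxK hr.le hxr hmin
    (fst_mem_proxNormalCone_reachableWithin hr.le hxr hp)
  obtain ⟨σ, hσ, hN⟩ := hp
  have hN' : ∀ w b, 0 ≤ b → minTime F K w ≤ ENNReal.ofReal b →
      inner ℝ p.fst (w - x) + p.snd * (b - r) ≤ σ * (‖w - x‖ ^ 2 + (b - r) ^ 2) := by
    intro w b hb hw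
    have := hN (WithLp.toLp 2 (w, b)) (mem_epigraph_minTime_iff.2 ⟨hb, hw⟩)
    rwa [inner_toLp_sub, norm_toLp_sub_sq] at this
  have hsmall : ∀ {a c δ : ℝ}, 0 < δ → 0 ≤ c → (∀ s, 0 < s → s ≤ δ → a ≤ c * s) → a ≤ 0 := by
    intro a c δ hδ hc H
    by_contra! ha
    have h1 := H (min δ (a / (2 * (c + 1)))) (by positivity) (min_le_left _ _)
    have h2 := mul_le_mul_of_nonneg_left (min_le_right δ (a / (2 * (c + 1)))) hc
    have h3 : c * (a / (2 * (c + 1))) ≤ a / 2 := by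
      rw [mul_div_assoc', div_le_div_iff₀ (by positivity) (by norm_num)]
      nlinarith
    linarith
  apply le_antisymm
  -- Tested against `(w, r + s)` with `w` near `x - s • v₀`, the inequality bounds the last
  -- coordinate above.
  · obtain ⟨C, δ, hC, hδ, H⟩ := hF.exists_backward K x
    set B := C * δ + ‖v₀‖ with hB
    refine sub_nonpos.1 (hsmall (c := σ * (B ^ 2 + 1) + ‖p.fst‖ * C) hδ (by positivity)
      fun s hs hsδ => ?_)
    obtain ⟨w, hw, hwx⟩ := H x (by simpa using hδ.le) s hs.le hsδ v₀ hv₀ r hr.le hxr.le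
    have h1 := hN' w (r + s) (by linarith) hw
    rw [sub_self, norm_zero, zero_add] at hwx
    have h2 : ‖w - x‖ ≤ B * s := by
      have n1 := norm_sub_le (w - (x - s • v₀)) (s • v₀)
      rw [show w - (x - s • v₀) - s • v₀ = w - x by abel, norm_smul,
        Real.norm_of_nonneg hs.le] at n1
      have n2 : C * s * s ≤ C * s * δ := by gcongr
      linarith
    have h3 : σ * ‖w - x‖ ^ 2 ≤ σ * (B * s) ^ 2 := by gcongr
    have h4 := real_inner_le_norm p.fst ((x - s • v₀) - w)
    rw [norm_sub_rev] at h4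
    have h5 := mul_le_mul_of_nonneg_left hwx (norm_nonneg p.fst)
    have h6 : inner ℝ p.fst ((x - s • v₀) - w)
        = -inner ℝ p.fst (w - x) - s * inner ℝ p.fst v₀ := by
      simp only [inner_sub_right, real_inner_smul_right]; ring
    refine le_of_mul_le_mul_left ?_ hs
    rw [show r + s - r = s by ring] at h1
    linarith
  -- Tested against `(w, r + s ^ 2 - s)`, it gives the reverse bound. The slack `s ^ 2` is of the
  -- order of the error, and `s ≤ r` keeps the height nonnegative.
  · obtain ⟨C, δ, hC, hδ, H⟩ := hF.exists_forward K hmin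
    refine sub_nonpos.1 (hsmall (c := σ * (C ^ 2 + (1 + δ) ^ 2) + C + |p.snd|)
      (δ := min δ r) (by positivity) (by positivity) fun s hs hsδ => ?_)
    have hsδ' := hsδ.trans (min_le_left _ _)
    have hsr := hsδ.trans (min_le_right _ _)
    obtain ⟨τ, w, hτ0, hτs, -, hw, -, hwx, hin⟩ := H x (by simpa using hδ.le) s hs.le hsδ'
      r (s ^ 2) hr.le (by positivity) hxr.le
    have h1 := hN' w (r + s ^ 2 - s) (by nlinarith) hw
    rw [sub_self, norm_zero, zero_add] at hin
    have h2 : σ * ‖w - x‖ ^ 2 ≤ σ * (C * s) ^ 2 := by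
      have : C * τ ≤ C * s := by gcongr
      gcongr
      exact hwx.trans this
    have h3 : C * τ * s ≤ C * s * s := by gcongr
    have h4 : s * inner ℝ p.fst v₀ ≤ τ * inner ℝ p.fst v₀ := mul_le_mul_of_nonpos_right hτs h0
    have h5 : -(|p.snd| * s ^ 2) ≤ p.snd * s ^ 2 := by
      rw [← neg_mul]
      exact mul_le_mul_of_nonneg_right (neg_abs_le _) (sq_nonneg s)
    have h6 : σ * (s ^ 2 - s) ^ 2 ≤ σ * ((1 + δ) ^ 2 * s ^ 2) := by
      rw [show (s ^ 2 - s) ^ 2 = (s - 1) ^ 2 * s ^ 2 by ring]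
      have : (s - 1) ^ 2 ≤ (1 + δ) ^ 2 := by nlinarith
      gcongr
    rw [show r + s ^ 2 - s - r = s ^ 2 - s by ring] at h1
    refine le_of_mul_le_mul_left ?_ hs
    linarith

end MinTime

/-! ### Equality of the dimensions. -/

theorem mainTheorem4 {n : ℕ}
    (F : EuclideanSpace ℝ (Fin n) → Set (EuclideanSpace ℝ (Fin n)))
    (hF : MinTime.AssumptionF F)
    (K : Set (EuclideanSpace ℝ (Fin n))) (hK : IsClosed K)
    (x : EuclideanSpace ℝ (Fin n)) (hx : x ∈ MinTime.reachableSet F K \ K) :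
    (∀ κ : ℕ,
      MinTime.ConeHasDim
          (MinTime.proxNormalCone (MinTime.reachableWithin F K (MinTime.minTime F K x)) x) κ ↔
        MinTime.ConeHasDim
          (MinTime.proxNormalCone
            (MinTime.epigraph (fun y => ((MinTime.minTime F K y : ℝ≥0∞) : EReal)))
            (WithLp.toLp 2 (x, (MinTime.minTime F K x).toReal))) κ) ∧
    Set.finrank ℝ
        (MinTime.proxNormalCone (MinTime.reachableWithin F K (MinTime.minTime F K x)) x) =
      Set.finrank ℝ
        (MinTime.proxNormalCone
          (MinTime.epigraph (fun y => ((MinTime.minTime F K y : ℝ≥0∞) : EReal)))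
          (WithLp.toLp 2 (x, (MinTime.minTime F K x).toReal))) := by
  obtain ⟨hxR, hxK⟩ := hx
  have hfin : MinTime.minTime F K x ≠ ⊤ := ne_of_lt hxR
  set r := (MinTime.minTime F K x).toReal with hrdef
  have hxr : MinTime.minTime F K x = ENNReal.ofReal r := (ENNReal.ofReal_toReal hfin).symm
  have hr : 0 < r := ENNReal.toReal_pos (hF.minTime_pos hK hxK).ne' hfin
  have hmin : ∀ ζ, ∃ v₀ ∈ F x, ∀ v ∈ F x, inner ℝ ζ v₀ ≤ inner ℝ ζ v := fun ζ => by
    obtain ⟨v₀, hv₀, hm⟩ := (hF.compact x).exists_isMinOn (hF.nonempty x)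
      (f := fun v => inner ℝ ζ v) (by fun_prop)
    exact ⟨v₀, hv₀, fun v hv => hm hv⟩
  set D := MinTime.proxNormalCone
    (MinTime.epigraph (fun y => ((MinTime.minTime F K y : ℝ≥0∞) : EReal)))
    (WithLp.toLp 2 (x, r)) with hD
  let π := WithLp.fstₗ 2 ℝ (EuclideanSpace ℝ (Fin n)) ℝ
  have himage : MinTime.proxNormalCone
      (MinTime.reachableWithin F K (MinTime.minTime F K x)) x = π '' D := by
    refine Subset.antisymm (fun ζ hζ => ?_) ?_
    · obtain ⟨v₀, hv₀, hm⟩ := hmin ζ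
      exact ⟨_, hF.toLp_mem_proxNormalCone_epigraph hxK hr.le hxr hv₀ hm hζ, rfl⟩
    · rintro _ ⟨p, hp, rfl⟩
      exact MinTime.fst_mem_proxNormalCone_reachableWithin hr.le hxr hp
  have hinjD : ∀ p ∈ D, ∀ q ∈ D, p.fst = q.fst → p = q := fun p hp q hq hpq => by
    obtain ⟨v₀, hv₀, hm⟩ := hmin p.fst
    have h1 := hF.snd_eq_of_mem_proxNormalCone_epigraph hxK hr hxr hv₀ hm hp
    have h2 := hF.snd_eq_of_mem_proxNormalCone_epigraph hxK hr hxr hv₀ (hpq ▸ hm) hq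
    exact WithLp.ofLp_injective 2 (Prod.ext hpq (h1.trans (hpq ▸ h2.symm)))
  -- A difference `p - q` of cone elements killed by `π` has `p.fst = q.fst`, hence `p = q`.
  have hinj : InjOn π (Submodule.span ℝ D) := fun a ha b hb hab => by
    obtain ⟨p, hp, q, hq, hpq⟩ := MinTime.exists_sub_of_mem_span
      MinTime.zero_mem_proxNormalCone (fun _ hv _ hw => MinTime.add_mem_proxNormalCone hv hw)
      (fun _ hc _ hv => MinTime.smul_mem_proxNormalCone hc hv) (Submodule.sub_mem _ ha hb)
    have h0 : π (p - q) = 0 := by rw [← hpq, map_sub, hab, sub_self]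
    rw [map_sub, sub_eq_zero] at h0
    rw [hinjD p hp q hq h0, sub_self] at hpq
    exact sub_eq_zero.1 hpq
  rw [himage]
  exact ⟨fun κ => MinTime.coneHasDim_image_iff π hinj κ, MinTime.finrank_image_eq π hinj⟩
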